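/- Let $A$ be a finite-dimensional local commutative associative unital $\mathbb{C}$-algebra with maximal ideal $\mathfrak m$, and let $U\subseteq\mathfrak m$ be a subspace with $\dim U=\dim A-2$ that generates $A$ as a unital algebra; such a pair $(A,U)$ is called an H-pair. The additive group of $U$ acts on $\mathbb{P}(A)$ by $u\circ[a]=[\exp(u)a]$. Let $X\subseteq\mathbb{P}(A)$ be the Zariski closure of the orbit of $[1]$; this is the hypersurface corresponding to $(A,U)$, and the action $\alpha$ of $U$ on $X$ is the corresponding additive action (an effective algebraic action with an open orbit that extends to $\mathbb{P}(A)$). An additive action of $G=\mathbb{G}_a^n$ on a variety $X$ with open orbit $O$ is said to satisfy the OP-condition if for every $G$-orbit $O'$ in $X$ there are a point $x\in O$ and a one-dimensional algebraic subgroup $H\subseteq G$ such that the closure in $X$ of the orbit $Hx$ intersects $O'$. Let $\mathrm{Soc}(A)=\{a\in A\mid a\mathfrak m=0\}$ and let $W$ be the ideal $U\cap\mathrm{Soc}(A)$ of $A$. Suppose that $\alpha$ satisfies the OP-condition. Then $A/W$ is local and $(A/W,U/W)$ is an H-pair. Let $Y\subseteq\mathbb{P}(A/W)$ be the closure of the orbit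 of $[1]$ under $U/W$. There is an integer $d\ge 2$ such that $X$ and $Y$ are irreducible hypersurfaces of degree $d$, and the action $\beta$ of $U/W$ on $Y$ is an additive action induced from $\mathbb{P}(A/W)$ and satisfies the OP-condition. -/

import Mathlib

open scoped LinearAlgebra.Projectivization Topology

noncomputable section

/-! ### The Zariski topology on a projective space, hypersurfaces -/

/-- The common zero locus in `ℙ(V)` of a set of polynomials in linear forms on `V`.
(It is used for homogeneous polynomials, for which the choice of representative is irrelevant.) -/
def zeroLocus {V : Type*} [AddCommGroup V] [Module ℂ V]
    (S : Set (MvPolynomial (Module.Dual ℂ V) ℂ)) : Set (ℙ ℂ V) :=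
  {x | ∀ f ∈ S, MvPolynomial.eval (fun φ : Module.Dual ℂ V => φ x.rep) f = 0}

/-- The Zariski topology on `ℙ(V)`: the closed sets are the common zero loci of sets of
homogeneous polynomials. -/
@[reducible]
def zariskiTopology (V : Type*) [AddCommGroup V] [Module ℂ V] : TopologicalSpace (ℙ ℂ V) :=
  TopologicalSpace.ofClosed
    {T | ∃ S : Set (MvPolynomial (Module.Dual ℂ V) ℂ),
      (∀ f ∈ S, ∃ k : ℕ, f.IsHomogeneous k) ∧ zeroLocus S = T}
    (by
      refine ⟨{1}, ?_, ?_⟩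
      · rintro f rfl
        exact ⟨0, MvPolynomial.isHomogeneous_one _ _⟩
      · ext x
        simp [zeroLocus])
    (by
      intro C hC
      have hC' : ∀ T ∈ C, ∃ S : Set (MvPolynomial (Module.Dual ℂ V) ℂ),
          (∀ f ∈ S, ∃ k : ℕ, f.IsHomogeneous k) ∧ zeroLocus S = T := fun T hT => hC hT
      choose! S hS hS' using hC'
      refine ⟨⋃ T ∈ C, S T, ?_, ?_⟩
      · intro f hf
        simp only [Set.mem_iUnion] at hf
        obtain ⟨T, hT, hf⟩ := hf
        exact hS T hT f hf
      · ext x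
        simp only [zeroLocus, Set.mem_iUnion, Set.mem_sInter, Set.mem_ofPred_eq]
        constructor
        · intro h T hT
          rw [← hS' T hT]
          exact fun f hf => h f ⟨T, hT, hf⟩
        · rintro h f ⟨T, hT, hf⟩
          have := h T hT
          rw [← hS' T hT] at this
          exact this f hf)
    (by
      rintro _ ⟨S, hS, rfl⟩ _ ⟨T, hT, rfl⟩
      refine ⟨Set.image2 (· * ·) S T, ?_, ?_⟩
      · rintro _ ⟨f, hf, g, hg, rfl⟩
        obtain ⟨k, hk⟩ := hS f hf
        obtain ⟨l, hl⟩ := hT g hg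
        exact ⟨k + l, hk.mul hl⟩
      · ext x
        constructor
        · intro h
          by_contra hx
          simp only [Set.mem_union, not_or, zeroLocus, Set.mem_ofPred_eq, not_forall] at hx
          obtain ⟨⟨f, hf, hf0⟩, ⟨g, hg, hg0⟩⟩ := hx
          have := h _ ⟨f, hf, g, hg, rfl⟩
          rw [map_mul] at this
          exact (mul_ne_zero hf0 hg0) this
        · rintro (h | h) _ ⟨f, hf, g, hg, rfl⟩
          · rw [map_mul, h f hf, zero_mul]
          · rw [map_mul, h g hg, mul_zero])

/-- The Zariski closure of a subset of `ℙ(V)`. -/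
def zariskiClosure {V : Type*} [AddCommGroup V] [Module ℂ V] (S : Set (ℙ ℂ V)) : Set (ℙ ℂ V) :=
  @closure _ (zariskiTopology V) S

/-- `X ⊆ ℙ(V)` is an (irreducible) hypersurface of degree `d`: in some homogeneous coordinates it
is the zero locus of an irreducible homogeneous polynomial of degree `d`. -/
def IsHypersurfaceOfDegree {V : Type*} [AddCommGroup V] [Module ℂ V]
    (X : Set (ℙ ℂ V)) (d : ℕ) : Prop :=
  ∃ (b : Module.Basis (Fin (Module.finrank ℂ V)) ℂ V)
    (f : MvPolynomial (Fin (Module.finrank ℂ V)) ℂ),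
    f.IsHomogeneous d ∧ Irreducible f ∧
      X = {x : ℙ ℂ V | MvPolynomial.eval (fun i => b.repr x.rep i) f = 0}

/-! ### Actions of vector groups on projective spaces -/

section Actions

/-- An action of the vector group `G` on `ℙ(V)` is algebraic: the map `G × ℙ(V) → ℙ(V)` is given,
locally around each point, by a vector of polynomials in coordinates of `G` and of `V` which are
homogeneous (of one degree) in the coordinates of `V`. -/
def IsAlgebraicAction (G : Type*) {V : Type*} [AddCommGroup G] [Module ℂ G]
    [AddCommGroup V] [Module ℂ V] [AddAction G (ℙ ℂ V)] : Prop :=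
  ∀ (g₀ : G) (x₀ : ℙ ℂ V), ∃ (k n : ℕ) (w : Fin n → V)
    (F : Fin n → MvPolynomial (Module.Dual ℂ V) (MvPolynomial (Module.Dual ℂ G) ℂ)),
    (∀ i, (F i).IsHomogeneous k) ∧
    let P : G → ℙ ℂ V → V := fun g x => ∑ i, MvPolynomial.eval (fun φ : Module.Dual ℂ V => φ x.rep)
      (MvPolynomial.map (MvPolynomial.eval (fun ψ : Module.Dual ℂ G => ψ g)) (F i)) • w i
    P g₀ x₀ ≠ 0 ∧
      ∀ (g : G) (x : ℙ ℂ V) (hne : P g x ≠ 0), g +ᵥ x = Projectivization.mk ℂ (P g x) hne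

/-- `O` is an orbit of `G` in `X` that is open in `X` for the Zariski topology. -/
def IsOpenOrbit (G : Type*) {V : Type*} [AddCommGroup G]
    [AddCommGroup V] [Module ℂ V] [AddAction G (ℙ ℂ V)] (X O : Set (ℙ ℂ V)) : Prop :=
  (∃ x ∈ X, O = AddAction.orbit G x) ∧
    ∃ T : Set (ℙ ℂ V), IsOpen[zariskiTopology V] T ∧ O = T ∩ X

/-- The action of the vector group `G` on `ℙ(V)` restricts to an (induced) additive action on
`X ⊆ ℙ(V)`: an effective algebraic action with an open orbit. -/
structure IsInducedAdditiveAction (G : Type*) {V : Type*} [AddCommGroup G] [Module ℂ G]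
    [AddCommGroup V] [Module ℂ V] [AddAction G (ℙ ℂ V)] (X : Set (ℙ ℂ V)) : Prop where
  algebraic : IsAlgebraicAction G (V := V)
  invariant : ∀ (g : G), ∀ x ∈ X, g +ᵥ x ∈ X
  effective : ∀ g : G, (∀ x ∈ X, g +ᵥ x = x) → g = 0
  exists_openOrbit : ∃ O, IsOpenOrbit G X O

/-- The OP-condition for an additive action of the vector group `G` on a Zariski closed subset `X`
of `ℙ(V)`: for every orbit `O'` in `X` there are a point `x` of the open orbit `O` and a
one-dimensional algebraic subgroup `H` of `G` (that is, a line in the vector space `G`) such that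
the closure of the orbit `H x` meets `O'`. -/
def OPCondition (G : Type*) {V : Type*} [AddCommGroup G] [Module ℂ G]
    [AddCommGroup V] [Module ℂ V] [AddAction G (ℙ ℂ V)] (X : Set (ℙ ℂ V)) : Prop :=
  ∃ O, IsOpenOrbit G X O ∧
    ∀ y ∈ X, ∃ x ∈ O, ∃ H : Submodule ℂ G, Module.finrank ℂ H = 1 ∧
      (zariskiClosure {z | ∃ g ∈ H, z = g +ᵥ x} ∩ AddAction.orbit G y).Nonempty

end Actions

/-! ### Local algebras, the exponential, the socle -/

/-- The exponential `∑ aⁱ / i!` of a nilpotent element of a `ℂ`-algebra. -/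
def nilExp {A : Type*} [CommRing A] [Algebra ℂ A] (a : A) : A :=
  ∑ i ∈ Finset.range (nilpotencyClass a), ((i.factorial : ℂ)⁻¹) • a ^ i

theorem nilExp_add {A : Type*} [CommRing A] [Algebra ℂ A] {a b : A}
    (ha : IsNilpotent a) (hb : IsNilpotent b) : nilExp (a + b) = nilExp a * nilExp b := by
  let _ : Algebra ℚ A := Algebra.compHom A (algebraMap ℚ ℂ)
  have key : ∀ c : A, nilExp c = IsNilpotent.exp c := by
    intro c
    unfold nilExp IsNilpotent.exp
    refine Finset.sum_congr rfl fun i _ => ?_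
    change _ = (algebraMap ℚ ℂ (i.factorial : ℚ)⁻¹) • c ^ i
    simp
  rw [key, key, key]
  exact IsNilpotent.exp_add_of_commute (Commute.all a b) ha hb

theorem nilExp_zero {A : Type*} [CommRing A] [Nontrivial A] [Algebra ℂ A] :
    nilExp (0 : A) = 1 := by
  simp [nilExp, nilpotencyClass_zero]

/-- The socle `{a ∈ A | a 𝔪 = 0}` of a local algebra. -/
def socle (A : Type*) [CommRing A] [IsLocalRing A] : Ideal A where
  carrier := {a | ∀ m ∈ IsLocalRing.maximalIdeal A, a * m = 0}
  add_mem' := by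
    intro a b ha hb m hm
    rw [add_mul, ha m hm, hb m hm, add_zero]
  zero_mem' := by
    intro m _
    exact zero_mul m
  smul_mem' := by
    intro c a ha m hm
    rw [smul_eq_mul, mul_assoc, ha m hm, mul_zero]

/-! ### H-pairs -/

/-- `(A, U)` is an H-pair: `A` is a finite-dimensional local `ℂ`-algebra (unital, commutative) with
maximal ideal `𝔪`, and `U ⊆ 𝔪` is a subspace with `dim U = dim A - 2` that generates `A` as a
unital algebra. -/
structure IsHPair {A : Type*} [CommRing A] [Algebra ℂ A] [IsLocalRing A] [FiniteDimensional ℂ A]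
    (U : Submodule ℂ A) : Prop where
  le_maximalIdeal : ∀ u ∈ U, u ∈ IsLocalRing.maximalIdeal A
  finrank_add_two : Module.finrank ℂ U + 2 = Module.finrank ℂ A
  adjoin_eq_top : Algebra.adjoin ℂ (U : Set A) = ⊤

namespace IsHPair

variable {A : Type*} [CommRing A] [Algebra ℂ A] [IsLocalRing A] [FiniteDimensional ℂ A]
  {U : Submodule ℂ A}

theorem isNilpotent (h : IsHPair U) (u : U) : IsNilpotent (u : A) := by
  have : IsArtinianRing A := IsArtinianRing.of_finite ℂ A
  have h1 : (u : A) ∈ Ring.jacobson A := by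
    rw [IsLocalRing.ringJacobson_eq_maximalIdeal]
    exact h.le_maximalIdeal u u.2
  obtain ⟨n, hn⟩ := IsArtinianRing.isNilpotent_jacobson_bot (R := A)
  refine ⟨n, ?_⟩
  have h2 : (u : A) ∈ Ideal.jacobson (⊥ : Ideal A) := by
    rwa [IsLocalRing.jacobson_eq_maximalIdeal _ bot_ne_top, ← IsLocalRing.ringJacobson_eq_maximalIdeal]
  have h3 := Ideal.pow_mem_pow h2 n
  rw [hn] at h3
  simpa using h3

/-- `exp(u)` as an invertible element of `A`, for `u ∈ U`. -/
def expUnit (h : IsHPair U) (u : U) : Aˣ where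
  val := nilExp (u : A)
  inv := nilExp (-(u : A))
  val_inv := by
    rw [← nilExp_add (h.isNilpotent u) (h.isNilpotent u).neg, add_neg_cancel, nilExp_zero]
  inv_val := by
    rw [← nilExp_add (h.isNilpotent u).neg (h.isNilpotent u), neg_add_cancel, nilExp_zero]

/-- The action of the additive group of `U` on `ℙ(A)` given by `u ∘ [a] = [exp(u) a]`. -/
@[reducible]
def addAction (h : IsHPair U) : AddAction U (ℙ ℂ A) where
  vadd u x := h.expUnit u • x
  zero_vadd x := by
    have : h.expUnit 0 = 1 := Units.ext (by simp [expUnit, nilExp_zero])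
    change h.expUnit 0 • x = x
    rw [this, one_smul]
  add_vadd u v x := by
    have : h.expUnit (u + v) = h.expUnit u * h.expUnit v :=
      Units.ext (by simp [expUnit, nilExp_add (h.isNilpotent u) (h.isNilpotent v)])
    change h.expUnit (u + v) • x = h.expUnit u • h.expUnit v • x
    rw [this, mul_smul]

theorem vadd_mk (h : IsHPair U) (u : U) (a : A) (ha : a ≠ 0)
    (ha' : nilExp (u : A) * a ≠ 0) :
    (letI := h.addAction; u +ᵥ Projectivization.mk ℂ a ha) =
      Projectivization.mk ℂ (nilExp (u : A) * a) ha' := rfl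

/-- The hypersurface corresponding to an H-pair: the Zariski closure in `ℙ(A)` of the `U`-orbit
of `[1]`. -/
def hypersurface (h : IsHPair U) : Set (ℙ ℂ A) :=
  letI := h.addAction
  zariskiClosure (AddAction.orbit U (Projectivization.mk ℂ (1 : A) one_ne_zero))

/-- The action of `U` on the corresponding hypersurface is an (induced) additive action. -/
def ActsAdditively (h : IsHPair U) : Prop :=
  letI := h.addAction
  IsInducedAdditiveAction U h.hypersurface

/-- The additive action corresponding to an H-pair, that is, the action of `U` on the
corresponding hypersurface, satisfies the OP-condition. -/
def SatisfiesOP (h : IsHPair U) : Prop :=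
  letI := h.addAction
  OPCondition U h.hypersurface

end IsHPair

/-! ### The quotient of an H-pair -/

/-- The ideal `W = U ∩ Soc(A)`. -/
def socIdeal {A : Type*} [CommRing A] [Algebra ℂ A] [IsLocalRing A] [FiniteDimensional ℂ A]
    (U : Submodule ℂ A) : Ideal A where
  carrier := {w | w ∈ U ∧ w ∈ socle A}
  add_mem' := fun ha hb => ⟨add_mem ha.1 hb.1, add_mem ha.2 hb.2⟩
  zero_mem' := ⟨zero_mem _, zero_mem _⟩
  smul_mem' := by
    rintro c w ⟨hw, hw'⟩
    refine ⟨?_, (socle A).smul_mem c hw'⟩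
    obtain ⟨z, hz⟩ := spectrum.nonempty_of_isAlgClosed_of_finiteDimensional ℂ c
    have hm : algebraMap ℂ A z - c ∈ IsLocalRing.maximalIdeal A :=
      (IsLocalRing.mem_maximalIdeal _).2 (spectrum.mem_iff.1 hz)
    have h0 := hw' _ hm
    have hcw : c • w = z • w := by
      rw [smul_eq_mul, Algebra.smul_def]
      linear_combination -h0
    rw [hcw]
    exact U.smul_mem z hw

/-- The subspace `U / W` of the quotient algebra `A / W`. -/
def quotientSubspace {A : Type*} [CommRing A] [Algebra ℂ A] [IsLocalRing A]
    [FiniteDimensional ℂ A] (U : Submodule ℂ A) : Submodule ℂ (A ⧸ socIdeal U) :=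
  U.map (Ideal.Quotient.mkₐ ℂ (socIdeal U)).toLinearMap

end

/-!
The hypersurface `X` of an H-pair `(A, U)` has an explicit equation. Let `ε : A → ℂ` be the residue
map, with kernel `𝔪`, and let `lam` be a linear form with `lam 1 = 0` that cuts out `U` in `𝔪`. The
exponential is a bijection from `𝔪` onto `1 + 𝔪`, so the orbit of `[1]` is given by `ε(z) ≠ 0` and
`lam (log (z / ε(z))) = 0`. Clearing denominators gives the form `logForm ε lam d`, whose degree `d`
is the largest exponent for which some `z ∈ 𝔪` has `z ^ d ∉ U`. It is irreducible
(`IsLogFormDatum.irreducible`): the substitution `c + y ↦ c · exp y` turns it into `ε ^ d · lam`, a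
product of linear forms, and `ε` does not divide it. By the Nullstellensatz its zero locus is the
closure of the orbit (`IsHPair.mk_mem_hypersurface_iff`).

Since `W ⊆ U`, the form of `(A / W, U / W)` composed with the projection `A → A / W` is the form of
`(A, U)`. Hence both hypersurfaces have the same degree, and every point of `Y` lifts to `X`. Given
such a lift `y`, the OP-condition for `X` supplies a point in the orbit of `y` and in the closure of
some `H x`, with `x` in the open orbit. Linear projections are continuous for the Zariski topology
where they are defined (`mk_map_mem_zariskiClosure`), so the image of this point lies in the closure
of the orbit of the image of `x` under the image of `H`, or under any line if `H ⊆ W`. This is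
`IsHPair.satisfiesOP_quotient`.
-/

noncomputable section

/-! ### Exponential and logarithm in a nilpotent ideal -/

section ExpLog

open Finset Polynomial

variable {A : Type*} [CommRing A] [Algebra ℂ A]

theorem nilExp_eq_sum {a : A} {N : ℕ} (h : a ^ N = 0) :
    nilExp a = ∑ i ∈ range N, ((i.factorial : ℂ)⁻¹) • a ^ i := by
  have hN : IsNilpotent a := ⟨N, h⟩
  refine sum_subset (range_subset_range.2 (csInf_le' h)) fun i _ hi => ?_
  rw [pow_eq_zero_of_le (not_lt.1 fun hlt => hi (mem_range.2 hlt)) (pow_nilpotencyClass hN),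
    smul_zero]

theorem map_nilExp {B : Type*} [CommRing B] [Algebra ℂ B] (f : A →ₐ[ℂ] B) {a : A}
    (ha : IsNilpotent a) : f (nilExp a) = nilExp (f a) := by
  obtain ⟨N, hN⟩ := ha
  rw [nilExp_eq_sum hN, nilExp_eq_sum (a := f a) (N := N) (by rw [← map_pow, hN, map_zero])]
  simp

/-- To second order, `exp a = 1 + a`. -/
theorem exists_nilExp_eq {a : A} (ha : IsNilpotent a) : ∃ r, nilExp a = 1 + a + a ^ 2 * r := by
  obtain ⟨N, hN⟩ := ha
  rw [nilExp_eq_sum (pow_eq_zero_of_le (Nat.le_add_right N 2) hN)]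
  refine ⟨∑ i ∈ range N, (((i + 2).factorial : ℂ)⁻¹) • a ^ i, ?_⟩
  rw [sum_range_succ', sum_range_succ', mul_sum]
  simp only [mul_smul_comm, ← pow_add, add_comm 2]
  simp
  ring

/-- The truncated logarithm series inverts the exponential. The identity `log (exp (t y)) = t y` is
obtained in `A[t]` by comparing derivatives. -/
theorem sum_log_nilExp {y : A} {N : ℕ} (hy : y ^ N = 0) :
    ∑ i ∈ range N, ((-1) ^ i / (i + 1) : ℂ) • (nilExp y - 1) ^ (i + 1) = y := by
  rcases subsingleton_or_nontrivial A with _ | _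
  · exact Subsingleton.elim _ _
  obtain ⟨k, rfl⟩ : ∃ k, N = k + 1 :=
    Nat.exists_eq_succ_of_ne_zero (by rintro rfl; simp at hy)
  -- `P = exp (t y)` and `Q = log P - t y`
  set P : A[X] := ∑ i ∈ range (k + 1), C (((i.factorial : ℂ)⁻¹) • y ^ i) * X ^ i with hP
  have hP' : derivative P = C y * P := by
    rw [hP, derivative_sum, sum_range_succ', mul_sum, sum_range_succ _ k]
    have h0 : C y * (C (((k.factorial : ℂ)⁻¹) • y ^ k) * X ^ k) = 0 := by
      rw [← mul_assoc, ← C_mul, mul_smul_comm, ← pow_succ', hy]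
      simp
    rw [h0, add_zero]
    simp only [Nat.factorial_zero, pow_zero, mul_one, derivative_C, add_zero]
    refine sum_congr rfl fun i _ => ?_
    rw [derivative_C_mul, derivative_X_pow, ← mul_assoc, ← mul_assoc, ← C_mul, ← C_mul,
      Nat.add_sub_cancel]
    congr 2
    rw [mul_smul_comm, ← pow_succ', Nat.factorial_succ, smul_mul_assoc, mul_comm (y ^ (i + 1))]
    rw [show ((i + 1 : ℕ) : A) = algebraMap ℂ A ((i + 1 : ℕ) : ℂ) by simp, ← Algebra.smul_def,
      smul_smul]
    congr 1
    push_cast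
    have : (i : ℂ) + 1 ≠ 0 := Nat.cast_add_one_ne_zero i
    have := Nat.cast_ne_zero (R := ℂ).2 (Nat.factorial_ne_zero i)
    field_simp
  have hP1 : ∃ R, 1 - P = C y * R := by
    refine ⟨-∑ i ∈ range k, C ((((i + 1).factorial : ℂ)⁻¹) • y ^ i) * X ^ (i + 1), ?_⟩
    rw [hP, sum_range_succ', mul_neg, mul_sum]
    simp only [← mul_assoc, ← C_mul, mul_smul_comm, ← pow_succ']
    simp
  have hPN : (1 - P) ^ (k + 1) = 0 := by
    obtain ⟨R, hR⟩ := hP1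
    rw [hR, mul_pow, ← C_pow, hy, C_0, zero_mul]
  set Q : A[X] := ∑ i ∈ range (k + 1), ((-1) ^ i / (i + 1) : ℂ) • (P - 1) ^ (i + 1) - C y * X
    with hQ
  -- the sum has derivative `y P ∑ (1 - P) ^ i = y`, a geometric series
  have hQ' : derivative Q = 0 := by
    have h1 : ∀ i ∈ range (k + 1),
        derivative (((-1) ^ i / (i + 1) : ℂ) • (P - 1) ^ (i + 1)) = (1 - P) ^ i * (C y * P) := by
      intro i _
      have h2 : ((i + 1 : ℕ) : A[X]) = algebraMap ℂ A[X] ((i + 1 : ℕ) : ℂ) := by simp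
      rw [derivative_smul, derivative_pow_succ, derivative_sub, derivative_one, sub_zero, hP',
        show C ((i : A) + 1) = ((i + 1 : ℕ) : A[X]) by simp, h2, ← smul_mul_assoc, ← Algebra.smul_def, smul_smul]
      have h3 : ((-1) ^ i / (i + 1) : ℂ) * ((i + 1 : ℕ) : ℂ) = (-1) ^ i := by
        have : (i : ℂ) + 1 ≠ 0 := Nat.cast_add_one_ne_zero i
        push_cast
        field_simp
      rw [h3, Algebra.smul_def, map_pow, map_neg, map_one, ← mul_pow]
      congr 2
      ring
    rw [hQ, derivative_sub, derivative_sum, sum_congr rfl h1, ← sum_mul]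
    have h4 := mul_neg_geom_sum (1 - P) (k + 1)
    rw [hPN, sub_zero, sub_sub_cancel] at h4
    rw [show (∑ i ∈ range (k + 1), (1 - P) ^ i) * (C y * P)
      = C y * (P * ∑ i ∈ range (k + 1), (1 - P) ^ i) by ring, h4]
    simp
  have hQc : Q = C (Q.coeff 0) := by
    let _ : Algebra ℚ A := Algebra.compHom A (algebraMap ℚ ℂ)
    have : IsAddTorsionFree A := IsAddTorsionFree.of_module_rat A
    exact eq_C_of_derivative_eq_zero hQ'
  have e0 : eval 0 Q = 0 := by
    have : eval 0 P = 1 := by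
      rw [hP, eval_finsetSum, sum_range_succ']
      simp
    rw [hQ, eval_sub, eval_finsetSum]
    simp [eval_smul, this]
  have e1 : eval 1 Q = 0 := by
    rw [hQc] at e0 ⊢
    rw [eval_C] at e0 ⊢
    exact e0
  have hPe : eval 1 P = nilExp y := by
    rw [nilExp_eq_sum hy, hP, eval_finsetSum]
    simp
  rw [hQ, eval_sub, eval_finsetSum] at e1
  simpa [eval_smul, hPe, sub_eq_zero] using e1

theorem nilExp_inj {x y : A} (hx : IsNilpotent x) (hy : IsNilpotent y)
    (h : nilExp x = nilExp y) : x = y := by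
  obtain ⟨N, hN⟩ := hx
  obtain ⟨M, hM⟩ := hy
  rw [← sum_log_nilExp (pow_eq_zero_of_le (Nat.le_add_right N M) hN),
    ← sum_log_nilExp (pow_eq_zero_of_le (Nat.le_add_left M N) hM), h]

/-- The exponential maps a nilpotent ideal `I` onto `1 + I`: modulo `I ^ (k + 1)`, multiplication
by `exp (-x)` removes an error term `x ∈ I ^ k`, and `exp` turns sums into products. -/
theorem exists_nilExp_eq_one_add {I : Ideal A} (hI : IsNilpotent I) {z : A} (hz : z ∈ I) :
    ∃ y ∈ I, nilExp y = 1 + z := by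
  rcases subsingleton_or_nontrivial A with _ | _
  · exact ⟨z, hz, Subsingleton.elim _ _⟩
  obtain ⟨N, hN⟩ := hI
  have hnil : ∀ x ∈ I, IsNilpotent x := fun x hx =>
    ⟨N, by simpa [hN] using Ideal.pow_mem_pow hx N⟩
  have key : ∀ j k : ℕ, N ≤ k + 1 + j → ∀ x ∈ I ^ (k + 1), ∃ y ∈ I, nilExp y = 1 + x := by
    intro j
    induction j with
    | zero =>
      intro k hk x hx
      have : x = 0 := by simpa [hN] using Ideal.pow_le_pow_right hk hx
      exact ⟨0, I.zero_mem, by rw [this, nilExp_zero, add_zero]⟩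
    | succ j ih =>
      intro k hk x hx
      have hxI : x ∈ I := Ideal.pow_le_self (Nat.succ_ne_zero k) hx
      obtain ⟨r, hr⟩ := exists_nilExp_eq (hnil (-x) (I.neg_mem hxI))
      have hx2 : x ^ 2 ∈ I ^ (k + 1 + 1) := by
        rw [sq, pow_succ]
        exact Ideal.mul_mem_mul hx hxI
      have hmem : x ^ 2 * (r + x * r - 1) ∈ I ^ (k + 1 + 1) := Ideal.mul_mem_right _ _ hx2
      obtain ⟨y, hy, hye⟩ := ih (k + 1) (by omega) _ hmem
      refine ⟨x + y, I.add_mem hxI hy, ?_⟩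
      have h1 : nilExp y = nilExp (-x) * (1 + x) := by
        rw [hye, hr]
        ring
      rw [nilExp_add (hnil x hxI) (hnil y hy), h1, ← mul_assoc,
        ← nilExp_add (hnil x hxI) (hnil _ (I.neg_mem hxI)), add_neg_cancel, nilExp_zero, one_mul]
  exact key N 0 (by omega) z (by simpa using hz)

end ExpLog

/-! ### Homogeneous polynomials and the Zariski closure -/

section Zariski

variable {V V' : Type*} [AddCommGroup V] [Module ℂ V] [AddCommGroup V'] [Module ℂ V']

theorem MvPolynomial.IsHomogeneous.eval_smul {σ R : Type*} [CommSemiring R] {F : MvPolynomial σ R}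
    {k : ℕ} (hF : F.IsHomogeneous k) (c : R) (x : σ → R) :
    MvPolynomial.eval (c • x) F = c ^ k * MvPolynomial.eval x F := by
  rw [MvPolynomial.eval_eq, MvPolynomial.eval_eq, Finset.mul_sum]
  refine Finset.sum_congr rfl fun m hm => ?_
  have hk : ∑ i ∈ m.support, m i = k := (hF.degree_eq_sum_deg_support hm).symm
  simp only [Pi.smul_apply, smul_eq_mul, mul_pow, Finset.prod_mul_distrib]
  rw [Finset.prod_pow_eq_pow_sum, hk]
  ring

/-- The vanishing of a homogeneous function at a point of `ℙ(V)` does not depend on the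
representative. -/
theorem apply_rep_eq_zero_iff {f : V → ℂ} {k : ℕ} (hf : ∀ (c : ℂ) (v : V), f (c • v) = c ^ k * f v)
    (v : V) (hv : v ≠ 0) : f (Projectivization.mk ℂ v hv).rep = 0 ↔ f v = 0 := by
  obtain ⟨a, ha⟩ := Projectivization.exists_smul_eq_mk_rep ℂ v hv
  rw [← ha, Units.smul_def, hf]
  simp

theorem eval_dual_smul {F : MvPolynomial (Module.Dual ℂ V) ℂ} {k : ℕ} (hF : F.IsHomogeneous k)
    (c : ℂ) (v : V) : MvPolynomial.eval (fun φ : Module.Dual ℂ V => φ (c • v)) F =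
      c ^ k * MvPolynomial.eval (fun φ : Module.Dual ℂ V => φ v) F := by
  rw [← hF.eval_smul]
  congr 2
  ext φ
  simp

theorem eval_dual_rep_eq_zero_iff {F : MvPolynomial (Module.Dual ℂ V) ℂ} {k : ℕ}
    (hF : F.IsHomogeneous k) (v : V) (hv : v ≠ 0) :
    MvPolynomial.eval (fun φ : Module.Dual ℂ V => φ (Projectivization.mk ℂ v hv).rep) F = 0 ↔
      MvPolynomial.eval (fun φ : Module.Dual ℂ V => φ v) F = 0 :=
  apply_rep_eq_zero_iff (f := fun v => MvPolynomial.eval (fun φ : Module.Dual ℂ V => φ v) F)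
    (eval_dual_smul hF) v hv

theorem isClosed_zariskiTopology_iff {T : Set (ℙ ℂ V)} :
    IsClosed[zariskiTopology V] T ↔ ∃ S : Set (MvPolynomial (Module.Dual ℂ V) ℂ),
      (∀ f ∈ S, ∃ k : ℕ, f.IsHomogeneous k) ∧ zeroLocus S = T := by
  rw [← @isOpen_compl_iff _ _ (zariskiTopology V)]
  change Tᶜᶜ ∈ _ ↔ _
  rw [compl_compl]
  rfl

/-- Membership in a Zariski closure, tested on homogeneous polynomials and on arbitrary
representatives. -/
theorem mk_mem_zariskiClosure_iff {S : Set (ℙ ℂ V)} {v : V} (hv : v ≠ 0) :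
    Projectivization.mk ℂ v hv ∈ zariskiClosure S ↔
      ∀ (F : MvPolynomial (Module.Dual ℂ V) ℂ) (k : ℕ), F.IsHomogeneous k →
        (∀ (w : V) (hw : w ≠ 0), Projectivization.mk ℂ w hw ∈ S →
          MvPolynomial.eval (fun φ : Module.Dual ℂ V => φ w) F = 0) →
        MvPolynomial.eval (fun φ : Module.Dual ℂ V => φ v) F = 0 := by
  let _ := zariskiTopology V
  constructor
  · intro h F k hF hS
    have hcl : IsClosed (zeroLocus {F}) :=
      isClosed_zariskiTopology_iff.2 ⟨{F}, by rintro f rfl; exact ⟨k, hF⟩, rfl⟩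
    have hsub : S ⊆ zeroLocus {F} := by
      rintro s hs f rfl
      exact hS s.rep s.rep_nonzero (by rwa [s.mk_rep])
    have := closure_minimal hsub hcl h F rfl
    exact (eval_dual_rep_eq_zero_iff hF v hv).1 this
  · intro h
    rw [zariskiClosure, mem_closure_iff]
    intro o ho hvo
    by_contra hne
    obtain ⟨T, hT, hTo⟩ := isClosed_zariskiTopology_iff.1 ho.isClosed_compl
    have hST : S ⊆ zeroLocus T := by
      rw [hTo]
      exact fun s hs hso => hne ⟨s, hso, hs⟩
    have : Projectivization.mk ℂ v hv ∈ zeroLocus T := by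
      intro F hF
      obtain ⟨k, hk⟩ := hT F hF
      refine (eval_dual_rep_eq_zero_iff hk v hv).2 (h F k hk fun w hw hwS => ?_)
      exact (eval_dual_rep_eq_zero_iff hk w hw).1 (hST hwS F hF)
    rw [hTo] at this
    exact this hvo

theorem subset_zariskiClosure (S : Set (ℙ ℂ V)) : S ⊆ zariskiClosure S :=
  @subset_closure _ (zariskiTopology V) S

/-- The rational map of projective spaces defined by a linear map is continuous where it is
defined. -/
theorem mk_map_mem_zariskiClosure (q : V →ₗ[ℂ] V') {S : Set (ℙ ℂ V)} {S' : Set (ℙ ℂ V')}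
    (hS : ∀ (w : V) (hw : w ≠ 0), Projectivization.mk ℂ w hw ∈ S →
      ∃ hq : q w ≠ 0, Projectivization.mk ℂ (q w) hq ∈ S')
    {v : V} (hv : v ≠ 0) (hvS : Projectivization.mk ℂ v hv ∈ zariskiClosure S) (hqv : q v ≠ 0) :
    Projectivization.mk ℂ (q v) hqv ∈ zariskiClosure S' := by
  rw [mk_mem_zariskiClosure_iff] at hvS ⊢
  intro F k hF hF0
  have he : ∀ w : V, MvPolynomial.eval (fun φ : Module.Dual ℂ V => φ w)
      (MvPolynomial.rename (fun φ : Module.Dual ℂ V' => φ ∘ₗ q) F) =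
      MvPolynomial.eval (fun φ : Module.Dual ℂ V' => φ (q w)) F := fun w => by
    rw [MvPolynomial.eval_rename]
    rfl
  rw [← he]
  refine hvS _ k hF.rename_isHomogeneous fun w hw hwS => ?_
  obtain ⟨hq, hqS⟩ := hS w hw hwS
  rw [he]
  exact hF0 _ hq hqS

/-- The set of points where a linear form does not vanish is Zariski open. -/
theorem isOpen_dual_ne_zero (ℓ : Module.Dual ℂ V) :
    IsOpen[zariskiTopology V] {x : ℙ ℂ V | ℓ x.rep ≠ 0} := by
  let _ := zariskiTopology V
  rw [← isClosed_compl_iff, isClosed_zariskiTopology_iff]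
  refine ⟨{MvPolynomial.X ℓ}, ?_, ?_⟩
  · rintro f rfl
    exact ⟨1, MvPolynomial.isHomogeneous_X _ _⟩
  · ext x
    simp [zeroLocus]

end Zariski

/-! ### Homogeneous polynomial maps -/

section PolyMap

variable {V W σ : Type*} [AddCommGroup W] [Module ℂ W] {c : V → σ → ℂ}

/-- `p : V → W` is a homogeneous polynomial map of degree `k` in the coordinates `c` of `V`: after
composition with any linear form on `W`, it is a homogeneous polynomial in these coordinates. -/
def IsHomogeneousPolyMap (c : V → σ → ℂ) (k : ℕ) (p : V → W) : Prop :=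
  ∀ φ : Module.Dual ℂ W, ∃ F : MvPolynomial σ ℂ, F.IsHomogeneous k ∧
    ∀ v, φ (p v) = MvPolynomial.eval (c v) F

namespace IsHomogeneousPolyMap

theorem comp_linear {W' : Type*} [AddCommGroup W'] [Module ℂ W'] {k : ℕ} {p : V → W}
    (hp : IsHomogeneousPolyMap c k p) (T : W →ₗ[ℂ] W') :
    IsHomogeneousPolyMap c k fun v => T (p v) := fun φ => hp (φ ∘ₗ T)

theorem const (w : W) : IsHomogeneousPolyMap c 0 fun _ => w := fun φ =>
  ⟨MvPolynomial.C (φ w), MvPolynomial.isHomogeneous_C _ _, fun _ => by simp⟩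

theorem sum {ι : Type*} (s : Finset ι) {k : ℕ} {p : ι → V → W}
    (hp : ∀ i ∈ s, IsHomogeneousPolyMap c k (p i)) :
    IsHomogeneousPolyMap c k fun v => ∑ i ∈ s, p i v := by
  intro φ
  choose! F hF hFe using fun i hi => hp i hi φ
  refine ⟨∑ i ∈ s, F i, MvPolynomial.IsHomogeneous.sum _ _ _ hF, fun v => ?_⟩
  rw [map_sum, map_sum]
  exact Finset.sum_congr rfl fun i hi => hFe i hi v

variable {A : Type*} [CommRing A] [Algebra ℂ A] [FiniteDimensional ℂ A]

theorem mul {k l : ℕ} {p q : V → A} (hp : IsHomogeneousPolyMap c k p)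
    (hq : IsHomogeneousPolyMap c l q) : IsHomogeneousPolyMap c (k + l) fun v => p v * q v := by
  intro φ
  let b := Module.finBasis ℂ A
  choose F hF hFe using fun i => hp (b.coord i)
  choose G hG hGe using fun i => hq (b.coord i)
  refine ⟨∑ i, ∑ j, MvPolynomial.C (φ (b i * b j)) * (F i * G j), ?_, fun v => ?_⟩
  · exact MvPolynomial.IsHomogeneous.sum _ _ _ fun i _ => MvPolynomial.IsHomogeneous.sum _ _ _
      fun j _ => ((hF i).mul (hG j)).C_mul _
  · beta_reduce
    conv_lhs => rw [← b.sum_repr (p v), ← b.sum_repr (q v), Finset.sum_mul_sum]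
    simp only [map_sum, smul_mul_smul_comm, map_smul, map_mul, MvPolynomial.eval_C, ← hFe, ← hGe,
      Module.Basis.coord_apply, smul_eq_mul]
    exact Finset.sum_congr rfl fun i _ => Finset.sum_congr rfl fun j _ => mul_comm _ _

theorem pow {k : ℕ} {p : V → A} (hp : IsHomogeneousPolyMap c k p) (n : ℕ) :
    IsHomogeneousPolyMap c (k * n) fun v => p v ^ n := by
  induction n with
  | zero => simpa using const (c := c) (1 : A)
  | succ n ih =>
    simp only [pow_succ]
    exact ih.mul hp

end IsHomogeneousPolyMap

/-- Linear maps are homogeneous of degree one in the coordinates with respect to a basis. -/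
theorem LinearMap.isHomogeneousPolyMap {ι : Type*} [Fintype ι] [AddCommGroup V] [Module ℂ V]
    (b : Module.Basis ι ℂ V) (T : V →ₗ[ℂ] W) :
    IsHomogeneousPolyMap (fun v i => b.repr v i) 1 T := by
  intro φ
  refine ⟨∑ i, MvPolynomial.C (φ (T (b i))) * MvPolynomial.X i, ?_, fun v => ?_⟩
  · exact MvPolynomial.IsHomogeneous.sum _ _ _ fun i _ => MvPolynomial.isHomogeneous_C_mul_X _ _
  · conv_lhs => rw [← b.sum_repr v]
    simp only [map_sum, map_smul, map_mul, MvPolynomial.eval_C, MvPolynomial.eval_X, smul_eq_mul]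
    exact Finset.sum_congr rfl fun i _ => mul_comm _ _

/-- Linear maps are homogeneous of degree one in the coordinates given by all linear forms. -/
theorem LinearMap.isHomogeneousPolyMap_dual [AddCommGroup V] [Module ℂ V] (T : V →ₗ[ℂ] W) :
    IsHomogeneousPolyMap (fun (v : V) (ψ : Module.Dual ℂ V) => ψ v) 1 T := fun φ =>
  ⟨MvPolynomial.X (φ ∘ₗ T), MvPolynomial.isHomogeneous_X _ _, fun v => by simp⟩

/-- A finite sum of homogeneous polynomial maps is given by polynomials. -/
theorem exists_eval_eq_sum {ι : Type*} (s : Finset ι) {k : ι → ℕ} {p : ι → V → W}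
    (hp : ∀ i ∈ s, IsHomogeneousPolyMap c (k i) (p i)) (φ : Module.Dual ℂ W) :
    ∃ F : MvPolynomial σ ℂ, ∀ v, φ (∑ i ∈ s, p i v) = MvPolynomial.eval (c v) F := by
  choose! F hF hFe using fun i hi => hp i hi φ
  refine ⟨∑ i ∈ s, F i, fun v => ?_⟩
  rw [map_sum, map_sum]
  exact Finset.sum_congr rfl fun i hi => hFe i hi v

/-- Polynomials in the coordinates with respect to a basis are determined by their values. -/
theorem MvPolynomial.ext_of_basis {ι : Type*} [Finite ι] [AddCommGroup V] [Module ℂ V]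
    (b : Module.Basis ι ℂ V) {F G : MvPolynomial ι ℂ}
    (h : ∀ v, MvPolynomial.eval (fun i => b.repr v i) F = MvPolynomial.eval (fun i => b.repr v i) G) :
    F = G := by
  refine MvPolynomial.funext fun x => ?_
  have hx : (fun i => b.repr (b.equivFun.symm x) i) = x := b.equivFun.apply_symm_apply x
  simpa only [hx] using h (b.equivFun.symm x)

end PolyMap

/-! ### The logarithmic form of a local algebra -/

section LogForm

variable {A : Type*} [CommRing A] [Algebra ℂ A] {ε : A →ₐ[ℂ] ℂ} {lam : A →ₗ[ℂ] ℂ} {d : ℕ}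

/-- For `ε : A → ℂ` with kernel `𝔪` and a linear form `lam`, the form
`z ↦ ε(z) ^ d · lam (log (z / ε(z)))` of degree `d`, with the logarithmic series truncated after its
`d`-th term; the denominators are cleared, so that it makes sense for `ε(z) = 0`. -/
def logForm (ε : A →ₐ[ℂ] ℂ) (lam : A →ₗ[ℂ] ℂ) (d : ℕ) (z : A) : ℂ :=
  ∑ i ∈ Finset.range d, ((-1) ^ i / (i + 1) : ℂ) •
    (ε z ^ (d - 1 - i) * lam ((z - algebraMap ℂ A (ε z)) ^ (i + 1)))

/-- The conditions under which `logForm ε lam d` is irreducible: `𝔪 = ker ε` is nilpotent, and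
`d ≥ 2` is the largest exponent for which `lam (z ^ d)` does not vanish identically on `𝔪`. -/
structure IsLogFormDatum (ε : A →ₐ[ℂ] ℂ) (lam : A →ₗ[ℂ] ℂ) (d : ℕ) : Prop where
  isNilpotent_ker : IsNilpotent (RingHom.ker ε)
  form_one : lam 1 = 0
  form_pow_eq_zero : ∀ z, ε z = 0 → ∀ i, d < i → lam (z ^ i) = 0
  exists_form_pow_ne_zero : ∃ z, ε z = 0 ∧ lam (z ^ d) ≠ 0
  two_le : 2 ≤ d

namespace IsLogFormDatum

theorem isNilpotent (h : IsLogFormDatum ε lam d) {z : A} (hz : ε z = 0) : IsNilpotent z := by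
  obtain ⟨N, hN⟩ := h.isNilpotent_ker
  exact ⟨N, by simpa [hN] using Ideal.pow_mem_pow ((RingHom.mem_ker).2 hz) N⟩

theorem map_nilExp_eq_one (h : IsLogFormDatum ε lam d) {y : A} (hy : ε y = 0) :
    ε (nilExp y) = 1 := by
  rw [map_nilExp ε (h.isNilpotent hy), hy, nilExp_zero]

theorem exists_eq_smul_nilExp (h : IsLogFormDatum ε lam d) {a : A} (ha : ε a ≠ 0) :
    ∃ y, ε y = 0 ∧ a = ε a • nilExp y := by
  obtain ⟨y, hy, hye⟩ := exists_nilExp_eq_one_add h.isNilpotent_ker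
    (z := (ε a)⁻¹ • a - 1) ((RingHom.mem_ker).2 (by simp [ha]))
  refine ⟨y, hy, ?_⟩
  rw [hye, add_sub_cancel, smul_inv_smul₀ ha]

theorem logForm_smul_nilExp (h : IsLogFormDatum ε lam d) (c : ℂ) {y : A} (hy : ε y = 0) :
    logForm ε lam d (c • nilExp y) = c ^ d * lam y := by
  have hc : ε (c • nilExp y) = c := by simp [h.map_nilExp_eq_one hy]
  have hz : ε (nilExp y - 1) = 0 := by simp [h.map_nilExp_eq_one hy]
  obtain ⟨N, hN⟩ := h.isNilpotent hy
  have hlog := congrArg lam (sum_log_nilExp (pow_eq_zero_of_le (Nat.le_add_left N d) hN))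
  rw [logForm, hc, ← hlog, map_sum, Finset.mul_sum]
  have hsub : Finset.range d ⊆ Finset.range (d + N) :=
    Finset.range_subset_range.2 (Nat.le_add_right d N)
  rw [← Finset.sum_subset hsub]
  · refine Finset.sum_congr rfl fun i hi => ?_
    have hi' := Finset.mem_range.1 hi
    rw [show c • nilExp y - algebraMap ℂ A c = c • (nilExp y - 1) by
      rw [smul_sub, Algebra.smul_def c (1 : A), mul_one], smul_pow, map_smul, map_smul,
      show c ^ d = c ^ (d - 1 - i) * c ^ (i + 1) by rw [← pow_add]; congr 1; omega]
    simp only [smul_eq_mul]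
    ring
  · intro i _ hi
    rw [map_smul, h.form_pow_eq_zero _ hz (i + 1) (by simpa [Nat.lt_succ_iff] using hi), smul_zero, mul_zero]

theorem logForm_of_map_eq_zero (h : IsLogFormDatum ε lam d) {z : A} (hz : ε z = 0) :
    logForm ε lam d z = ((-1) ^ (d - 1) / d) * lam (z ^ d) := by
  obtain ⟨k, rfl⟩ : ∃ k, d = k + 1 := ⟨d - 1, by have := h.two_le; omega⟩
  rw [logForm, Finset.sum_range_succ, Finset.sum_eq_zero]
  · simp [hz]
  · intro i hi
    have : k - i ≠ 0 := by have := Finset.mem_range.1 hi; omega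
    simp [hz, this]

end IsLogFormDatum

theorem isHomogeneousPolyMap_logForm [FiniteDimensional ℂ A] {σ : Type*} {c : A → σ → ℂ}
    (hc : IsHomogeneousPolyMap c 1 (fun a : A => a)) :
    IsHomogeneousPolyMap c d (logForm ε lam d) := by
  have hε := hc.comp_linear ε.toLinearMap
  have hδ := hc.comp_linear
    (LinearMap.id - (Algebra.linearMap ℂ A) ∘ₗ ε.toLinearMap : A →ₗ[ℂ] A)
  refine IsHomogeneousPolyMap.sum _ fun i hi => ?_
  have hi' := Finset.mem_range.1 hi
  have hterm := ((hε.pow (d - 1 - i)).mul ((hδ.pow (i + 1)).comp_linear lam)).comp_linear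
    (((-1) ^ i / (i + 1) : ℂ) • LinearMap.id : ℂ →ₗ[ℂ] ℂ)
  rw [show 1 * (d - 1 - i) + 1 * (i + 1) = d by omega] at hterm
  exact hterm

theorem logForm_comp {B : Type*} [CommRing B] [Algebra ℂ B] (q : A →ₐ[ℂ] B)
    (ε : B →ₐ[ℂ] ℂ) (lam : B →ₗ[ℂ] ℂ) (d : ℕ) (a : A) :
    logForm (ε.comp q) (lam ∘ₗ q.toLinearMap) d a = logForm ε lam d (q a) := by
  simp [logForm]

variable {ι : Type*}

/-- A nonzero linear form is a prime polynomial. -/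
theorem MvPolynomial.IsHomogeneous.prime_of_degree_one {F : MvPolynomial ι ℂ}
    (hF : F.IsHomogeneous 1) (h0 : F ≠ 0) : Prime F := by
  rw [← irreducible_iff_prime]
  refine MvPolynomial.irreducible_of_totalDegree_eq_one (hF.totalDegree h0) fun x hx => ?_
  rw [isUnit_iff_ne_zero]
  rintro rfl
  exact h0 (MvPolynomial.ext _ _ fun m => by simpa using hx m)

namespace IsLogFormDatum

variable [Fintype ι] [FiniteDimensional ℂ A]

/-- The form `logForm ε lam d` is irreducible. Under the substitution `c + y ↦ c · exp y` (`c ∈ ℂ`,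
`y ∈ 𝔪`) it becomes `ε ^ d · lam`, so one factor of any factorization becomes a power of `ε` up to a
scalar, hence is itself a power of `ε` up to a scalar, as the substitution maps onto `ε ≠ 0`. But
`ε` does not divide `logForm ε lam d`. -/
theorem irreducible (h : IsLogFormDatum ε lam d) (b : Module.Basis ι ℂ A) {f : MvPolynomial ι ℂ}
    (hf : ∀ a, logForm ε lam d a = MvPolynomial.eval (fun i => b.repr a i) f) :
    Irreducible f := by
  obtain ⟨F₀, hF₀, hF₀e⟩ := LinearMap.isHomogeneousPolyMap b ε.toLinearMap LinearMap.id
  obtain ⟨F₁, hF₁, hF₁e⟩ := LinearMap.isHomogeneousPolyMap b lam LinearMap.id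
  simp only [LinearMap.id_apply, AlgHom.toLinearMap_apply] at hF₀e hF₁e
  obtain ⟨z, hz, hzd⟩ := h.exists_form_pow_ne_zero
  have hp₀ : Prime F₀ := hF₀.prime_of_degree_one fun h0 => by simpa [h0] using hF₀e 1
  have hp₁ : Prime F₁ := hF₁.prime_of_degree_one fun h0 => hzd (by simpa [h0] using hF₁e (z ^ d))
  have hndvd : ¬ F₀ ∣ f := by
    rintro ⟨g, rfl⟩
    have h1 := hf z
    rw [map_mul, ← hF₀e, hz, zero_mul, h.logForm_of_map_eq_zero hz] at h1
    have hd : (d : ℂ) ≠ 0 := Nat.cast_ne_zero.2 (by have := h.two_le; omega)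
    exact mul_ne_zero (div_ne_zero (pow_ne_zero _ (by norm_num)) hd) hzd h1
  -- the substitution is `a ↦ ε a • exp (δ a)`, where `δ` is the projection onto `𝔪` along `ℂ`
  obtain ⟨N, hN⟩ := h.isNilpotent_ker
  set δ : A →ₗ[ℂ] A := LinearMap.id - (Algebra.linearMap ℂ A) ∘ₗ ε.toLinearMap
  have hδ : ∀ a, ε (δ a) = 0 := fun a => by simp [δ]
  have hlδ : ∀ a, lam (δ a) = lam a := fun a => by
    simp [δ, Algebra.algebraMap_eq_smul_one, h.form_one]
  have hΨ : ∀ φ : Module.Dual ℂ A, ∃ F : MvPolynomial ι ℂ, ∀ a,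
      φ (ε a • nilExp (δ a)) = MvPolynomial.eval (fun i => b.repr a i) F := by
    intro φ
    obtain ⟨F, hF⟩ := exists_eval_eq_sum (c := fun a i => b.repr a i) (Finset.range N)
      (k := fun i => 0 + (1 + 1 * i))
      (p := fun i a => algebraMap ℂ A (i.factorial : ℂ)⁻¹ * (algebraMap ℂ A (ε a) * δ a ^ i))
      (fun i _ => (IsHomogeneousPolyMap.const _).mul
        ((LinearMap.isHomogeneousPolyMap b ((Algebra.linearMap ℂ A) ∘ₗ ε.toLinearMap)).mul
          ((LinearMap.isHomogeneousPolyMap b δ).pow i))) φ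
    refine ⟨F, fun a => ?_⟩
    have hδN : δ a ^ N = 0 := by
      simpa [hN] using Ideal.pow_mem_pow ((RingHom.mem_ker).2 (hδ a)) N
    rw [← hF, nilExp_eq_sum hδN, Finset.smul_sum]
    refine congrArg φ (Finset.sum_congr rfl fun i _ => ?_)
    simp only [Algebra.smul_def]
    ring
  choose Ψ hΨe using fun i => hΨ (b.coord i)
  have hΦ : ∀ (p : MvPolynomial ι ℂ) (a : A),
      MvPolynomial.eval (fun i => b.repr a i) (MvPolynomial.aeval Ψ p) =
        MvPolynomial.eval (fun i => b.repr (ε a • nilExp (δ a)) i) p := by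
    intro p a
    rw [← MvPolynomial.coe_aeval_eq_eval, ← MvPolynomial.coe_aeval_eq_eval]
    change ((MvPolynomial.aeval _).comp (MvPolynomial.aeval Ψ)) p = _
    rw [MvPolynomial.comp_aeval]
    change MvPolynomial.aeval _ p = MvPolynomial.aeval _ p
    congr 2
    ext i
    exact (hΨe i a).symm
  have hΦf : MvPolynomial.aeval Ψ f = F₀ ^ d * F₁ := by
    refine MvPolynomial.ext_of_basis b fun a => ?_
    rw [hΦ, ← hf, h.logForm_smul_nilExp _ (hδ a), hlδ, map_mul, map_pow, hF₀e, hF₁e]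
  have key : ∀ p q : MvPolynomial ι ℂ, f = p * q → F₁ ∣ MvPolynomial.aeval Ψ p → IsUnit q := by
    rintro p q hpq ⟨r, hr⟩
    have h1 : r * MvPolynomial.aeval Ψ q = F₀ ^ d := by
      refine mul_left_cancel₀ hp₁.ne_zero ?_
      rw [← mul_assoc, ← hr, ← map_mul, ← hpq, hΦf, mul_comm]
    obtain ⟨m, -, u, hu⟩ := (dvd_prime_pow hp₀ d).1 (Dvd.intro_left r h1)
    obtain ⟨s, hs, hsu⟩ := (MvPolynomial.isUnit_iff_eq_C_of_isReduced).1 u.isUnit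
    -- the identity `q * C s = F₀ ^ m` holds where `ε ≠ 0`, hence everywhere
    have h2 : F₀ * (q * MvPolynomial.C s) = F₀ * F₀ ^ m := by
      refine MvPolynomial.ext_of_basis b fun a => ?_
      rw [map_mul, map_mul, map_mul, MvPolynomial.eval_C, map_pow, ← hF₀e]
      rcases eq_or_ne (ε a) 0 with ha | ha
      · rw [ha, zero_mul, zero_mul]
      obtain ⟨y, hy, hay⟩ := h.exists_eq_smul_nilExp ha
      have hε' : ε (algebraMap ℂ A (ε a) + y) = ε a := by simp [hy]
      have hδ' : δ (algebraMap ℂ A (ε a) + y) = y := by simp [δ, hy]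
      have h5 := congrArg
        (MvPolynomial.eval fun i => b.repr (algebraMap ℂ A (ε a) + y) i) hu
      rw [map_mul, hΦ, map_pow, ← hF₀e, hsu, MvPolynomial.eval_C, hε', hδ', ← hay] at h5
      rw [h5]
    have h3 := mul_left_cancel₀ hp₀.ne_zero h2
    rcases Nat.eq_zero_or_pos m with rfl | hm
    · exact IsUnit.of_mul_eq_one _ (by simpa using h3)
    · refine absurd ?_ hndvd
      have h4 : F₀ ∣ q * MvPolynomial.C s := h3 ▸ dvd_pow_self _ hm.ne'
      rw [hpq]
      exact (((hs.map MvPolynomial.C).dvd_mul_right).1 h4).mul_left p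
  constructor
  · intro hu
    have := hu.map (MvPolynomial.aeval (R := ℂ) Ψ)
    rw [hΦf] at this
    exact hp₁.not_isUnit (isUnit_of_mul_isUnit_right this)
  · intro p q hpq
    have h1 : F₁ ∣ MvPolynomial.aeval Ψ p * MvPolynomial.aeval Ψ q := by
      rw [← map_mul, ← hpq, hΦf]
      exact dvd_mul_left _ _
    rcases hp₁.dvd_or_dvd h1 with h2 | h2
    · exact Or.inr (key p q hpq h2)
    · exact Or.inl (key q p (by rw [hpq, mul_comm]) h2)

/-- A polynomial that vanishes on the part `ε ≠ 0` of the zero locus of `logForm ε lam d` vanishes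
on the whole zero locus. -/
theorem eval_eq_zero (h : IsLogFormDatum ε lam d) (b : Module.Basis ι ℂ A) {G : MvPolynomial ι ℂ}
    (hG : ∀ a, ε a ≠ 0 → logForm ε lam d a = 0 →
      MvPolynomial.eval (fun i => b.repr a i) G = 0) {a : A} (ha : logForm ε lam d a = 0) :
    MvPolynomial.eval (fun i => b.repr a i) G = 0 := by
  obtain ⟨f, hf, hfe⟩ := isHomogeneousPolyMap_logForm
    (LinearMap.isHomogeneousPolyMap b LinearMap.id) LinearMap.id
  simp only [LinearMap.id_apply] at hfe
  obtain ⟨F₀, hF₀, hF₀e⟩ := LinearMap.isHomogeneousPolyMap b ε.toLinearMap LinearMap.id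
  simp only [LinearMap.id_apply, AlgHom.toLinearMap_apply] at hF₀e
  have hirr := h.irreducible b hfe
  have hprime : Prime f := irreducible_iff_prime.1 hirr
  have : (Ideal.span {f}).IsPrime := (Ideal.span_singleton_prime hprime.ne_zero).2 hprime
  -- `ε` is a nonzero linear form, so it suffices that `ε · G` vanishes on the zero locus
  have hmem : F₀ * G ∈ MvPolynomial.vanishingIdeal ℂ
      (MvPolynomial.zeroLocus ℂ (Ideal.span {f})) := by
    intro x hx
    have hx' := hx f (Ideal.mem_span_singleton_self f)
    have hxa : (fun i => b.repr (b.equivFun.symm x) i) = x := b.equivFun.apply_symm_apply x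
    rw [← hxa, MvPolynomial.aeval_eq_eval] at hx' ⊢
    rw [← hfe] at hx'
    rw [map_mul, ← hF₀e, mul_eq_zero, or_iff_not_imp_left]
    exact fun h0 => hG _ h0 hx'
  rw [MvPolynomial.IsPrime.vanishingIdeal_zeroLocus, Ideal.mem_span_singleton] at hmem
  rcases hprime.dvd_or_dvd hmem with h1 | h1
  · exfalso
    have h0 : F₀ ≠ 0 := fun h0 => by simpa [h0] using hF₀e 1
    have := MvPolynomial.totalDegree_le_of_dvd_of_isDomain h1 h0
    rw [hf.totalDegree hprime.ne_zero, hF₀.totalDegree h0] at this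
    have := h.two_le
    omega
  · obtain ⟨r, rfl⟩ := h1
    rw [map_mul, ← hfe, ha, zero_mul]

end IsLogFormDatum

end LogForm

/-! ### The equation of the hypersurface of an H-pair -/

section HPair

variable {A : Type*} [CommRing A] [Algebra ℂ A] [IsLocalRing A] [FiniteDimensional ℂ A]
  {U : Submodule ℂ A}

variable (A) in
theorem exists_algHom_ker_eq_maximalIdeal :
    ∃ ε : A →ₐ[ℂ] ℂ, RingHom.ker ε = IsLocalRing.maximalIdeal A := by
  have hbij : Function.Bijective (Algebra.ofId ℂ (A ⧸ IsLocalRing.maximalIdeal A)) :=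
    IsAlgClosed.algebraMap_bijective_of_isIntegral
  let e := AlgEquiv.ofBijective _ hbij
  refine ⟨e.symm.toAlgHom.comp (Ideal.Quotient.mkₐ ℂ _), ?_⟩
  ext a
  rw [RingHom.mem_ker]
  change e.symm (Ideal.Quotient.mk _ a) = 0 ↔ _
  rw [map_eq_zero_iff _ e.symm.injective, Ideal.Quotient.eq_zero_iff_mem]

variable (A) in
theorem isNilpotent_maximalIdeal : IsNilpotent (IsLocalRing.maximalIdeal A) := by
  have : IsArtinianRing A := IsArtinianRing.of_finite ℂ A
  rw [← IsLocalRing.jacobson_eq_maximalIdeal ⊥ bot_ne_top]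
  exact IsArtinianRing.isNilpotent_jacobson_bot

/-- `ε : A → ℂ` is the residue map, and `lam` is a linear form that vanishes at `1` and cuts out `U`
in the maximal ideal. -/
structure IsDefiningForm (U : Submodule ℂ A) (ε : A →ₐ[ℂ] ℂ) (lam : A →ₗ[ℂ] ℂ) : Prop where
  ker_eq : RingHom.ker ε = IsLocalRing.maximalIdeal A
  form_one : lam 1 = 0
  mem_iff : ∀ a, a ∈ U ↔ ε a = 0 ∧ lam a = 0

namespace IsHPair

theorem exists_isDefiningForm (h : IsHPair U) : ∃ ε lam, IsDefiningForm U ε lam := by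
  obtain ⟨ε, hε⟩ := exists_algHom_ker_eq_maximalIdeal A
  have hUε : ∀ u ∈ U, ε u = 0 := fun u hu => by
    have := h.le_maximalIdeal u hu
    rwa [← hε, RingHom.mem_ker] at this
  have h1U : (1 : A) ∉ U := fun h1 => by simpa using hUε 1 h1
  have hfr : Module.finrank ℂ (U ⊔ Submodule.span ℂ {(1 : A)} : Submodule ℂ A) + 1 =
      Module.finrank ℂ A := by
    have h2 := Submodule.finrank_sup_add_finrank_inf_eq U (Submodule.span ℂ {(1 : A)})
    have hdisj : U ⊓ Submodule.span ℂ {(1 : A)} = ⊥ := by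
      rw [← disjoint_iff, Submodule.disjoint_span_singleton]
      exact fun h1 => absurd h1 h1U
    rw [hdisj, finrank_bot, finrank_span_singleton one_ne_zero] at h2
    have := h.finrank_add_two
    omega
  have hlt : U ⊔ Submodule.span ℂ {(1 : A)} < ⊤ := by
    rw [lt_top_iff_ne_top]
    intro htop
    rw [htop, finrank_top] at hfr
    omega
  obtain ⟨lam, hlam, hle⟩ := Submodule.exists_le_ker_of_lt_top _ hlt
  have hker : U ⊔ Submodule.span ℂ {(1 : A)} = LinearMap.ker lam := by
    refine Submodule.eq_of_le_of_finrank_eq hle ?_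
    have h3 := LinearMap.finrank_range_add_finrank_ker lam
    rw [LinearMap.range_eq_top.2 (LinearMap.surjective hlam), finrank_top,
      Module.finrank_self] at h3
    omega
  refine ⟨ε, lam, hε, hle (Submodule.mem_sup_right (Submodule.mem_span_singleton_self 1)),
    fun a => ⟨fun ha => ⟨hUε a ha, hle (Submodule.mem_sup_left ha)⟩, ?_⟩⟩
  rintro ⟨ha, hla⟩
  have hmem : a ∈ U ⊔ Submodule.span ℂ {(1 : A)} := hker ▸ hla
  obtain ⟨u, hu, v, hv, rfl⟩ := Submodule.mem_sup.1 hmem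
  obtain ⟨c, rfl⟩ := Submodule.mem_span_singleton.1 hv
  have hc : c = 0 := by simpa [hUε u hu] using ha
  simpa [hc] using hu

/-- The degree `d` is the largest exponent for which some `z ∈ 𝔪` has `z ^ d ∉ U`. It is at least
`2`: otherwise, by polarization, `U + ℂ` would be closed under multiplication, while `U` generates
`A`. -/
theorem exists_isLogFormDatum (h : IsHPair U) {ε : A →ₐ[ℂ] ℂ} {lam : A →ₗ[ℂ] ℂ}
    (hf : IsDefiningForm U ε lam) : ∃ d, IsLogFormDatum ε lam d := by
  classical
  obtain ⟨N, hN⟩ := isNilpotent_maximalIdeal A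
  have hzN : ∀ z, ε z = 0 → ∀ i, N ≤ i → z ^ i = 0 := fun z hz i hi => by
    have h1 : z ∈ IsLocalRing.maximalIdeal A := hf.ker_eq ▸ (RingHom.mem_ker).2 hz
    exact pow_eq_zero_of_le hi (by simpa [hN] using Ideal.pow_mem_pow h1 N)
  have hsq : ∃ z, ε z = 0 ∧ lam (z ^ 2) ≠ 0 := by
    by_contra! hcon
    have hmul : ∀ x ∈ U, ∀ y ∈ U, x * y ∈ U := by
      intro x hx y hy
      have hx0 := ((hf.mem_iff x).1 hx).1
      have hy0 := ((hf.mem_iff y).1 hy).1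
      refine (hf.mem_iff _).2 ⟨by simp [hx0], ?_⟩
      have h1 := hcon (x + y) (by simp [hx0, hy0])
      rw [show (x + y) ^ 2 = x ^ 2 + y ^ 2 + (2 : ℂ) • (x * y) by
        rw [ofNat_smul_eq_nsmul, nsmul_eq_mul]; push_cast; ring] at h1
      simpa [hcon x hx0, hcon y hy0] using h1
    have hall : ∀ a : A, a - algebraMap ℂ A (ε a) ∈ U := by
      intro a
      have ha : a ∈ Algebra.adjoin ℂ (U : Set A) := h.adjoin_eq_top ▸ Algebra.mem_top
      induction ha using Algebra.adjoin_induction with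
      | mem x hx => simpa [((hf.mem_iff x).1 hx).1] using hx
      | algebraMap r => simp
      | add x y _ _ hx hy =>
        rw [map_add, map_add, add_sub_add_comm]
        exact U.add_mem hx hy
      | mul x y _ _ hx hy =>
        have : x * y - algebraMap ℂ A (ε (x * y)) =
            (x - algebraMap ℂ A (ε x)) * (y - algebraMap ℂ A (ε y)) +
              ε x • (y - algebraMap ℂ A (ε y)) + ε y • (x - algebraMap ℂ A (ε x)) := by
          simp only [Algebra.smul_def, map_mul]
          ring
        rw [this]
        exact U.add_mem (U.add_mem (hmul _ hx _ hy) (U.smul_mem _ hy)) (U.smul_mem _ hx)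
    have hUker : U = LinearMap.ker ε.toLinearMap := by
      ext a
      refine ⟨fun ha => ((hf.mem_iff a).1 ha).1, fun ha => ?_⟩
      have ha' : ε a = 0 := ha
      simpa [ha'] using hall a
    have h3 := LinearMap.finrank_range_add_finrank_ker ε.toLinearMap
    have h4 := Submodule.finrank_le (LinearMap.range ε.toLinearMap)
    rw [Module.finrank_self] at h4
    have h5 := h.finrank_add_two
    rw [hUker] at h5
    omega
  have h2N : 2 ≤ N := by
    by_contra hlt
    obtain ⟨z, hz, hz2⟩ := hsq
    exact hz2 (by rw [hzN z hz 2 (by omega), map_zero])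
  have hspec := Nat.findGreatest_spec (P := fun i => ∃ z, ε z = 0 ∧ lam (z ^ i) ≠ 0) h2N hsq
  refine ⟨Nat.findGreatest (fun i => ∃ z, ε z = 0 ∧ lam (z ^ i) ≠ 0) N,
    hf.ker_eq ▸ isNilpotent_maximalIdeal A, hf.form_one, fun z hz i hi => ?_, hspec,
    Nat.le_findGreatest h2N hsq⟩
  by_contra hne
  rcases le_total i N with hiN | hiN
  · exact Nat.findGreatest_is_greatest hi hiN ⟨z, hz, hne⟩
  · exact hne (by rw [hzN z hz i hiN, map_zero])

/-- The orbit of `[1]`. -/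
def openOrbit (h : IsHPair U) : Set (ℙ ℂ A) :=
  letI := h.addAction
  AddAction.orbit U (Projectivization.mk ℂ (1 : A) one_ne_zero)

theorem nilExp_mul_ne_zero (h : IsHPair U) (u : U) {a : A} (ha : a ≠ 0) :
    nilExp (u : A) * a ≠ 0 :=
  fun h0 => ha ((h.expUnit u).isUnit.mul_right_eq_zero.1 h0)

variable {ε : A →ₐ[ℂ] ℂ} {lam : A →ₗ[ℂ] ℂ} {d : ℕ}

theorem mk_mem_openOrbit_iff (h : IsHPair U) (hf : IsDefiningForm U ε lam)
    (hd : IsLogFormDatum ε lam d) {a : A} (ha : a ≠ 0) :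
    Projectivization.mk ℂ a ha ∈ h.openOrbit ↔ ε a ≠ 0 ∧ logForm ε lam d a = 0 := by
  constructor
  · rintro ⟨u, hu⟩
    have hu' : Projectivization.mk ℂ (nilExp (u : A) * 1) (h.nilExp_mul_ne_zero u one_ne_zero) =
        Projectivization.mk ℂ a ha := hu
    obtain ⟨c, hc⟩ := (Projectivization.mk_eq_mk_iff ℂ _ _ _ _).1 hu'.symm
    obtain ⟨hu0, hul⟩ := (hf.mem_iff u).1 u.2
    have hc' : a = (c : ℂ) • nilExp (u : A) := by rw [← hc, mul_one, Units.smul_def]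
    rw [hc', hd.logForm_smul_nilExp _ hu0, hul]
    simp [hd.map_nilExp_eq_one hu0]
  · rintro ⟨hεa, hla⟩
    obtain ⟨y, hy, hay⟩ := hd.exists_eq_smul_nilExp hεa
    rw [hay, hd.logForm_smul_nilExp _ hy] at hla
    have hyU : y ∈ U := (hf.mem_iff y).2
      ⟨hy, (mul_eq_zero.1 hla).resolve_left (pow_ne_zero _ hεa)⟩
    refine ⟨⟨y, hyU⟩, ?_⟩
    change Projectivization.mk ℂ (nilExp y * 1) (h.nilExp_mul_ne_zero ⟨y, hyU⟩ one_ne_zero) = _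
    refine (Projectivization.mk_eq_mk_iff' ℂ _ _ _ _).2 ⟨(ε a)⁻¹, ?_⟩
    rw [inv_smul_eq_iff₀ hεa, mul_one]
    exact hay

/-- The hypersurface of an H-pair is the zero locus of its logarithmic form. -/
theorem mk_mem_hypersurface_iff (h : IsHPair U) (hf : IsDefiningForm U ε lam)
    (hd : IsLogFormDatum ε lam d) {a : A} (ha : a ≠ 0) :
    Projectivization.mk ℂ a ha ∈ h.hypersurface ↔ logForm ε lam d a = 0 := by
  change Projectivization.mk ℂ a ha ∈ zariskiClosure h.openOrbit ↔ _
  rw [mk_mem_zariskiClosure_iff]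
  constructor
  · intro hcl
    obtain ⟨F, hF, hFe⟩ := isHomogeneousPolyMap_logForm (ε := ε) (lam := lam) (d := d)
      (LinearMap.isHomogeneousPolyMap_dual LinearMap.id) LinearMap.id
    simp only [LinearMap.id_apply] at hFe
    rw [hFe]
    refine hcl F d hF fun w hw hwO => ?_
    rw [← hFe]
    exact ((h.mk_mem_openOrbit_iff hf hd hw).1 hwO).2
  · intro hla F k _ hFO
    let b := Module.finBasis ℂ A
    let G := MvPolynomial.aeval (fun φ : Module.Dual ℂ A =>
      ∑ i, MvPolynomial.C (φ (b i)) * MvPolynomial.X i) F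
    have hG : ∀ v : A, MvPolynomial.eval (fun i => b.repr v i) G =
        MvPolynomial.eval (fun φ : Module.Dual ℂ A => φ v) F := by
      intro v
      rw [← MvPolynomial.coe_aeval_eq_eval, ← MvPolynomial.coe_aeval_eq_eval]
      change ((MvPolynomial.aeval _).comp (MvPolynomial.aeval _)) F = _
      rw [MvPolynomial.comp_aeval]
      change MvPolynomial.aeval _ F = MvPolynomial.aeval _ F
      congr 2
      ext φ
      conv_rhs => rw [← b.sum_repr v]
      simp only [map_sum, map_mul, MvPolynomial.aeval_C, MvPolynomial.aeval_X, map_smul,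
        smul_eq_mul, Algebra.algebraMap_self, RingHom.id_apply]
      exact Finset.sum_congr rfl fun i _ => mul_comm _ _
    rw [← hG]
    refine hd.eval_eq_zero b (fun v hv hlv => ?_) hla
    have hv0 : v ≠ 0 := by
      rintro rfl
      exact hv (map_zero ε)
    rw [hG]
    exact hFO v hv0 ((h.mk_mem_openOrbit_iff hf hd hv0).2 ⟨hv, hlv⟩)

theorem isHypersurfaceOfDegree (h : IsHPair U) (hf : IsDefiningForm U ε lam)
    (hd : IsLogFormDatum ε lam d) : IsHypersurfaceOfDegree h.hypersurface d := by
  let b := Module.finBasis ℂ A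
  obtain ⟨f, hfd, hfe⟩ := isHomogeneousPolyMap_logForm (ε := ε) (lam := lam) (d := d)
    (LinearMap.isHomogeneousPolyMap b LinearMap.id) LinearMap.id
  simp only [LinearMap.id_apply] at hfe
  refine ⟨b, f, hfd, hd.irreducible b hfe, ?_⟩
  ext x
  rw [Set.mem_ofPred_eq, ← hfe, ← h.mk_mem_hypersurface_iff hf hd x.rep_nonzero, x.mk_rep]

/-! ### The additive action on the hypersurface -/

theorem isOpenOrbit_openOrbit (h : IsHPair U) :
    letI := h.addAction
    IsOpenOrbit U h.hypersurface h.openOrbit := by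
  let _ := h.addAction
  obtain ⟨ε, lam, hf⟩ := h.exists_isDefiningForm
  obtain ⟨d, hd⟩ := h.exists_isLogFormDatum hf
  refine ⟨⟨_, subset_zariskiClosure _ (AddAction.mem_orbit_self _), rfl⟩, _,
    isOpen_dual_ne_zero ε.toLinearMap, ?_⟩
  ext x
  rw [← x.mk_rep, h.mk_mem_openOrbit_iff hf hd, Set.mem_inter_iff,
    h.mk_mem_hypersurface_iff hf hd, x.mk_rep]
  rfl

theorem eq_openOrbit (h : IsHPair U) {O : Set (ℙ ℂ A)}
    (hO : letI := h.addAction; IsOpenOrbit U h.hypersurface O) : O = h.openOrbit := by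
  let _ := h.addAction
  let _ := zariskiTopology A
  obtain ⟨⟨x, hx, rfl⟩, T, hT, hOT⟩ := hO
  have hxT : x ∈ T := (hOT ▸ AddAction.mem_orbit_self (M := U) x : x ∈ T ∩ h.hypersurface).1
  have hx' : x ∈ closure h.openOrbit := hx
  obtain ⟨z, hzT, hz⟩ := mem_closure_iff.1 hx' T hT hxT
  have hzx : z ∈ AddAction.orbit U x := by
    rw [hOT]
    exact ⟨hzT, subset_closure hz⟩
  rw [← AddAction.orbit_eq_iff.2 hzx]
  exact AddAction.orbit_eq_iff.2 hz

/-- In the coordinates of `A`, the action is `(u, x) ↦ exp(u) x`, which is polynomial in `u` and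
linear in `x`. -/
theorem isAlgebraicAction (h : IsHPair U) :
    letI := h.addAction
    IsAlgebraicAction U (V := A) := by
  let _ := h.addAction
  obtain ⟨N, hN⟩ := isNilpotent_maximalIdeal A
  let b := Module.finBasis ℂ A
  have hpoly : ∀ i j, ∃ F : MvPolynomial (Module.Dual ℂ U) ℂ, ∀ u : U,
      b.coord i (nilExp (u : A) * b j) = MvPolynomial.eval (fun ψ : Module.Dual ℂ U => ψ u) F := by
    intro i j
    obtain ⟨F, hF⟩ := exists_eval_eq_sum (c := fun (u : U) (ψ : Module.Dual ℂ U) => ψ u)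
      (Finset.range N) (k := fun l => 0 + 1 * l)
      (p := fun l u => (((l.factorial : ℂ)⁻¹) • b j) * (u : A) ^ l)
      (fun l _ => (IsHomogeneousPolyMap.const _).mul
        ((LinearMap.isHomogeneousPolyMap_dual U.subtype).pow l)) (b.coord i)
    refine ⟨F, fun u => ?_⟩
    have huN : (u : A) ^ N = 0 := by
      simpa [hN] using Ideal.pow_mem_pow (h.le_maximalIdeal u u.2) N
    rw [← hF, nilExp_eq_sum huN, Finset.sum_mul]
    refine congrArg _ (Finset.sum_congr rfl fun l _ => ?_)
    rw [smul_mul_assoc, smul_mul_assoc, mul_comm]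
  choose E hE using hpoly
  intro g₀ x₀
  refine ⟨1, _, b, fun i => ∑ j, MvPolynomial.C (E i j) * MvPolynomial.X (b.coord j),
    fun i => MvPolynomial.IsHomogeneous.sum _ _ _ fun j _ =>
      MvPolynomial.isHomogeneous_C_mul_X _ _, ?_⟩
  intro P
  have hP : ∀ (g : U) (x : ℙ ℂ A), P g x = nilExp (g : A) * x.rep := by
    intro g x
    conv_rhs => rw [← b.sum_repr (nilExp (g : A) * x.rep)]
    refine Finset.sum_congr rfl fun i _ => ?_
    congr 1
    conv_rhs => rw [← b.sum_repr x.rep]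
    simp only [map_sum, map_mul, MvPolynomial.map_C, MvPolynomial.map_X, MvPolynomial.eval_C,
      MvPolynomial.eval_X, ← hE, Finset.mul_sum, mul_smul_comm, map_smul, Finsupp.coe_finsetSum,
      Finset.sum_apply, Finsupp.smul_apply, Module.Basis.coord_apply, smul_eq_mul]
    exact Finset.sum_congr rfl fun j _ => mul_comm _ _
  refine ⟨?_, fun g x hne => ?_⟩
  · rw [hP]
    exact h.nilExp_mul_ne_zero g₀ x₀.rep_nonzero
  · conv_lhs => rw [← x.mk_rep]
    rw [h.vadd_mk g x.rep x.rep_nonzero (h.nilExp_mul_ne_zero g x.rep_nonzero)]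
    congr 1
    exact (hP g x).symm

theorem actsAdditively (h : IsHPair U) : h.ActsAdditively := by
  let _ := h.addAction
  refine ⟨h.isAlgebraicAction, fun g x hx => ?_, fun g hg => ?_, _, h.isOpenOrbit_openOrbit⟩
  · rw [← x.mk_rep] at hx ⊢
    rw [h.vadd_mk g x.rep x.rep_nonzero (h.nilExp_mul_ne_zero g x.rep_nonzero)]
    refine mk_map_mem_zariskiClosure (LinearMap.mulLeft ℂ (nilExp (g : A)))
      (fun w hw hwO => ⟨h.nilExp_mul_ne_zero g hw, ?_⟩) x.rep_nonzero hx
      (h.nilExp_mul_ne_zero g x.rep_nonzero)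
    obtain ⟨u, hu⟩ := hwO
    refine ⟨g + u, ?_⟩
    change (g + u) +ᵥ _ = g +ᵥ Projectivization.mk ℂ w hw
    rw [← hu, add_vadd]
  · obtain ⟨ε, lam, hf⟩ := h.exists_isDefiningForm
    have h1 := hg (Projectivization.mk ℂ 1 one_ne_zero)
      (subset_zariskiClosure _ (AddAction.mem_orbit_self _))
    rw [h.vadd_mk g 1 one_ne_zero (h.nilExp_mul_ne_zero g one_ne_zero)] at h1
    obtain ⟨c, hc⟩ := (Projectivization.mk_eq_mk_iff' ℂ _ _ _ _).1 h1
    have hg0 := ((hf.mem_iff g).1 g.2).1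
    have hc1 : c = 1 := by
      have := congrArg ε hc
      rw [map_mul, map_nilExp ε (h.isNilpotent g), hg0, nilExp_zero] at this
      simpa using this
    have he : nilExp (g : A) = nilExp 0 := by
      rw [nilExp_zero, ← mul_one (nilExp (g : A)), ← hc, hc1, one_smul]
    exact Subtype.ext (nilExp_inj (h.isNilpotent g) IsNilpotent.zero he)

end IsHPair

end HPair

/-! ### The quotient by the ideal `W = U ∩ Soc(A)` -/

section Quotient

variable {A : Type*} [CommRing A] [Algebra ℂ A] [IsLocalRing A] [FiniteDimensional ℂ A]
  {U : Submodule ℂ A}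

namespace IsHPair

theorem socIdeal_ne_top (h : IsHPair U) : socIdeal U ≠ ⊤ := fun htop =>
  (Ideal.ne_top_iff_one _).1 (IsLocalRing.maximalIdeal.isMaximal A).ne_top
    (h.le_maximalIdeal 1 (htop ▸ Submodule.mem_top : (1 : A) ∈ socIdeal U).1)

theorem isLocalRing_quotient (h : IsHPair U) : IsLocalRing (A ⧸ socIdeal U) :=
  have : Nontrivial (A ⧸ socIdeal U) := Ideal.Quotient.nontrivial_iff.2 h.socIdeal_ne_top
  IsLocalRing.of_surjective' (Ideal.Quotient.mk (socIdeal U)) Ideal.Quotient.mk_surjective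

/-- A preimage of an element of `U / W` lies in `U`, as `W ⊆ U`. -/
theorem _root_.mk_mem_quotientSubspace_iff {a : A} :
    Ideal.Quotient.mkₐ ℂ (socIdeal U) a ∈ quotientSubspace U ↔ a ∈ U := by
  refine ⟨?_, fun ha => Submodule.mem_map_of_mem ha⟩
  rintro ⟨u, hu, hua⟩
  have h1 : u - a ∈ socIdeal U := Ideal.Quotient.eq.1 hua
  simpa using U.sub_mem hu h1.1

theorem quotient (h : IsHPair U) [IsLocalRing (A ⧸ socIdeal U)] : IsHPair (quotientSubspace U) where
  le_maximalIdeal := by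
    rintro _ ⟨u, hu, rfl⟩
    obtain ⟨n, hn⟩ := h.isNilpotent ⟨u, hu⟩
    refine (IsLocalRing.maximalIdeal.isMaximal _).isPrime.mem_of_pow_mem n ?_
    rw [AlgHom.toLinearMap_apply, ← map_pow, hn, map_zero]
    exact Ideal.zero_mem _
  finrank_add_two := by
    set q := (Ideal.Quotient.mkₐ ℂ (socIdeal U)).toLinearMap
    have hker : ∀ a, q a = 0 ↔ a ∈ (socIdeal U).restrictScalars ℂ := fun a =>
      Ideal.Quotient.eq_zero_iff_mem
    have h1 := LinearMap.finrank_range_add_finrank_ker q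
    have h2 := LinearMap.finrank_range_add_finrank_ker (q.domRestrict U)
    have hq : LinearMap.range q = ⊤ :=
      LinearMap.range_eq_top.2 (Ideal.Quotient.mkₐ_surjective ℂ _)
    have hk1 : LinearMap.ker q = (socIdeal U).restrictScalars ℂ := Submodule.ext hker
    have hk2 : LinearMap.ker (q.domRestrict U) =
        ((socIdeal U).restrictScalars ℂ).comap U.subtype :=
      Submodule.ext fun u => hker u
    have hk3 := (Submodule.comapSubtypeEquivOfLe
      (fun a ha => ha.1 : (socIdeal U).restrictScalars ℂ ≤ U)).finrank_eq
    rw [hq, finrank_top, hk1] at h1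
    rw [LinearMap.range_domRestrict, hk2, hk3] at h2
    change Module.finrank ℂ (U.map q) + 2 = _
    have := h.finrank_add_two
    omega
  adjoin_eq_top := by
    have h1 := (Ideal.Quotient.mkₐ ℂ (socIdeal U)).map_adjoin (U : Set A)
    rw [h.adjoin_eq_top, Algebra.map_top,
      (AlgHom.range_eq_top _).2 (Ideal.Quotient.mkₐ_surjective ℂ _)] at h1
    exact h1.symm

theorem ne_bot (h : IsHPair U) : U ≠ ⊥ := by
  rintro rfl
  have h1 := h.finrank_add_two
  have h2 := h.adjoin_eq_top
  rw [Submodule.bot_coe, Algebra.adjoin_singleton_zero,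
    Subalgebra.bot_eq_top_iff_finrank_eq_one] at h2
  rw [finrank_bot, h2] at h1
  omega

/-- A defining form for `(A / W, U / W)` pulls back to one for `(A, U)`. -/
theorem _root_.IsDefiningForm.comp_mk [IsLocalRing (A ⧸ socIdeal U)]
    {ε : A ⧸ socIdeal U →ₐ[ℂ] ℂ} {lam : A ⧸ socIdeal U →ₗ[ℂ] ℂ}
    (hf : IsDefiningForm (quotientSubspace U) ε lam) :
    IsDefiningForm U (ε.comp (Ideal.Quotient.mkₐ ℂ (socIdeal U)))
      (lam ∘ₗ (Ideal.Quotient.mkₐ ℂ (socIdeal U)).toLinearMap) where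
  ker_eq := by
    have hmax : (RingHom.ker (ε.comp (Ideal.Quotient.mkₐ ℂ (socIdeal U)))).IsMaximal :=
      RingHom.ker_isMaximal_of_surjective _ fun c => ⟨algebraMap ℂ A c, by simp⟩
    exact IsLocalRing.eq_maximalIdeal hmax
  form_one := by simpa using hf.form_one
  mem_iff a := by
    rw [← mk_mem_quotientSubspace_iff, hf.mem_iff]
    rfl

theorem _root_.IsLogFormDatum.comp_mk {ε : A ⧸ socIdeal U →ₐ[ℂ] ℂ}
    {lam : A ⧸ socIdeal U →ₗ[ℂ] ℂ} {d : ℕ} (hd : IsLogFormDatum ε lam d)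
    (hker : IsNilpotent (RingHom.ker (ε.comp (Ideal.Quotient.mkₐ ℂ (socIdeal U))))) :
    IsLogFormDatum (ε.comp (Ideal.Quotient.mkₐ ℂ (socIdeal U)))
      (lam ∘ₗ (Ideal.Quotient.mkₐ ℂ (socIdeal U)).toLinearMap) d where
  isNilpotent_ker := hker
  form_one := by simpa using hd.form_one
  form_pow_eq_zero z hz i hi := by
    have := hd.form_pow_eq_zero _ hz i hi
    rwa [← map_pow] at this
  exists_form_pow_ne_zero := by
    obtain ⟨z, hz, hzd⟩ := hd.exists_form_pow_ne_zero
    obtain ⟨a, rfl⟩ := Ideal.Quotient.mkₐ_surjective ℂ _ z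
    refine ⟨a, hz, ?_⟩
    rwa [← map_pow] at hzd
  two_le := hd.two_le

/-- The OP-condition descends to the quotient. Every point of `Y` lifts to a point of `X`, and the
projection of `ℙ(A)` from `ℙ(W)` maps the closure of an orbit `H x` into the closure of the orbit of
the image of `x` under any line `H'` of `U / W` that contains the image of `H`. -/
theorem satisfiesOP_quotient (h : IsHPair U) [IsLocalRing (A ⧸ socIdeal U)]
    (h' : IsHPair (quotientSubspace U)) (hOP : h.SatisfiesOP) : h'.SatisfiesOP := by
  let _ := h.addAction
  let _ := h'.addAction
  obtain ⟨ε, lam, hf'⟩ := h'.exists_isDefiningForm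
  obtain ⟨d, hd'⟩ := h'.exists_isLogFormDatum hf'
  have hf := hf'.comp_mk
  have hd := hd'.comp_mk (hf.ker_eq ▸ isNilpotent_maximalIdeal A)
  obtain ⟨O, hO, hOP⟩ := hOP
  obtain rfl := h.eq_openOrbit hO
  refine ⟨_, h'.isOpenOrbit_openOrbit, fun y' hy' => ?_⟩
  set q := Ideal.Quotient.mkₐ ℂ (socIdeal U)
  let T : U →ₗ[ℂ] quotientSubspace U := q.toLinearMap.submoduleMap U
  have hT : ∀ (u : U) (a : A), q (nilExp (u : A) * a) = nilExp (T u : A ⧸ socIdeal U) * q a := by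
    intro u a
    rw [map_mul, map_nilExp q (h.isNilpotent u)]
    rfl
  -- lift `y'` to `X`
  obtain ⟨a, ha⟩ := Ideal.Quotient.mkₐ_surjective ℂ (socIdeal U) y'.rep
  have hqa : q a ≠ 0 := by
    rw [ha]
    exact y'.rep_nonzero
  have ha0 : a ≠ 0 := fun h0 => hqa (by rw [h0, map_zero])
  have hy'a : y' = Projectivization.mk ℂ (q a) hqa := by
    rw [← y'.mk_rep]
    congr 1
    exact ha.symm
  have haX : Projectivization.mk ℂ a ha0 ∈ h.hypersurface := by
    rw [h.mk_mem_hypersurface_iff hf hd, logForm_comp]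
    exact (h'.mk_mem_hypersurface_iff hf' hd' hqa).1 (hy'a ▸ hy')
  obtain ⟨x, ⟨u₁, rfl⟩, H, hH, z, hz, u₀, rfl⟩ := hOP _ haX
  -- a line of `U / W` containing the image of `H`
  obtain ⟨H', hH', hHH'⟩ : ∃ H' : Submodule ℂ (quotientSubspace U),
      Module.finrank ℂ H' = 1 ∧ H.map T ≤ H' := by
    rcases eq_or_ne (H.map T) ⊥ with hbot | hbot
    · obtain ⟨v, hv, hv0⟩ := Submodule.exists_mem_ne_zero_of_ne_bot h'.ne_bot
      refine ⟨Submodule.span ℂ {⟨v, hv⟩}, finrank_span_singleton fun h0 => hv0 ?_, ?_⟩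
      · simpa using h0
      · rw [hbot]
        exact bot_le
    · refine ⟨H.map T, le_antisymm (hH ▸ Submodule.finrank_map_le T H) ?_, le_rfl⟩
      exact Submodule.one_le_finrank_iff.2 hbot
  have hx0 : nilExp (u₁ : A) * 1 ≠ 0 := h.nilExp_mul_ne_zero u₁ one_ne_zero
  have hqx : q (nilExp (u₁ : A) * 1) ≠ 0 := by
    rw [hT, map_one]
    exact h'.nilExp_mul_ne_zero _ one_ne_zero
  have hxO : Projectivization.mk ℂ (q (nilExp (u₁ : A) * 1)) hqx ∈ h'.openOrbit := by
    refine ⟨T u₁, ?_⟩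
    change Projectivization.mk ℂ (nilExp (T u₁ : A ⧸ socIdeal U) * 1)
      (h'.nilExp_mul_ne_zero _ one_ne_zero) = _
    congr 1
    rw [hT, map_one]
  have hqz : q (nilExp (u₀ : A) * a) ≠ 0 := by
    rw [hT]
    exact h'.nilExp_mul_ne_zero _ hqa
  refine ⟨_, hxO, H', hH', Projectivization.mk ℂ (q (nilExp (u₀ : A) * a)) hqz, ?_, T u₀, ?_⟩
  · refine mk_map_mem_zariskiClosure q.toLinearMap ?_ (h.nilExp_mul_ne_zero u₀ ha0) hz hqz
    rintro w hw ⟨g, hg, hwg⟩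
    have hwg' : Projectivization.mk ℂ w hw = Projectivization.mk ℂ
        (nilExp (g : A) * (nilExp (u₁ : A) * 1)) (h.nilExp_mul_ne_zero g hx0) := hwg
    obtain ⟨c, hc⟩ := (Projectivization.mk_eq_mk_iff ℂ _ _ _ _).1 hwg'
    have hqw : q w = c • (nilExp (T g : A ⧸ socIdeal U) * q (nilExp (u₁ : A) * 1)) := by
      rw [← hT, ← hc, Units.smul_def, Units.smul_def, map_smul]
    have hne := h'.nilExp_mul_ne_zero (T g) hqx
    refine ⟨?_, T g, hHH' (Submodule.mem_map_of_mem hg), ?_⟩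
    · rw [AlgHom.toLinearMap_apply, hqw]
      exact (smul_ne_zero_iff_ne c).2 hne
    · change _ = Projectivization.mk ℂ (nilExp (T g : A ⧸ socIdeal U) * _) hne
      exact (Projectivization.mk_eq_mk_iff ℂ _ _ _ _).2 ⟨c, hqw.symm⟩
  · rw [hy'a]
    change Projectivization.mk ℂ (nilExp (T u₀ : A ⧸ socIdeal U) * q a)
      (h'.nilExp_mul_ne_zero _ hqa) = _
    congr 1
    exact (hT u₀ a).symm

end IsHPair

end Quotient

end

theorem mainTheorem4 {A : Type*} [CommRing A] [Algebra ℂ A] [IsLocalRing A]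
    [FiniteDimensional ℂ A] (U : Submodule ℂ A) (h : IsHPair U) (hOP : h.SatisfiesOP) :
    ∃ (_ : IsLocalRing (A ⧸ socIdeal U)) (h' : IsHPair (quotientSubspace U)),
      (∃ d : ℕ, 2 ≤ d ∧ IsHypersurfaceOfDegree h.hypersurface d ∧
        IsHypersurfaceOfDegree h'.hypersurface d) ∧
      h'.ActsAdditively ∧
      h'.SatisfiesOP := by
  have hloc := h.isLocalRing_quotient
  have h' := h.quotient
  obtain ⟨ε, lam, hf'⟩ := h'.exists_isDefiningForm
  obtain ⟨d, hd'⟩ := h'.exists_isLogFormDatum hf'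
  have hf := hf'.comp_mk
  have hd := hd'.comp_mk (hf.ker_eq ▸ isNilpotent_maximalIdeal A)
  exact ⟨hloc, h', ⟨d, hd'.two_le, h.isHypersurfaceOfDegree hf hd,
    h'.isHypersurfaceOfDegree hf' hd'⟩, h'.actsAdditively, h.satisfiesOP_quotient h' hOP⟩
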